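/- Let $d\ge 1$, $B>0$, and let $P$ be a Borel probability distribution on $\{x\in\mathbb R^d:\|x\|\le B\}$ with mean $\mu_P$, where $\|\cdot\|$ is the Euclidean norm. Let $\varepsilon>0$ and let $Q$ be a Borel probability distribution, also carried by $\{x\in\mathbb R^d:\|x\|\le B\}$, with $D_{\mathrm{TV}}(P,Q)=\sup_{A\text{ Borel}}|P(A)-Q(A)|\le\varepsilon$. Let $X_1,X_2,\dots$ be iid with law $Q$, and let $(\lambda_t)_{t\ge1}$ be a predictable sequence with values in $(0,0.8]$, i.e. $\lambda_t$ is $\sigma(X_1,\dots,X_{t-1})$-measurable for every $t$ (in particular, any deterministic sequence in $(0,0.8]$ is allowed). Put $\psi_E(\lambda)=|\log(1-\lambda)+\lambda|$, $\bar\mu_0=0$, $\bar\mu_t=\frac1t\sum_{i\le t}X_i$ and $\overline Z_i=\|X_i-\bar\mu_{i-1}\|$. (i) For every $\alpha\in(0,1)$, with probability at least $1-\alpha$, simultaneously for all $t\ge1$, $$\left\|\frac{\sum_{i\le t}\lambda_iX_i}{\sum_{i\le t}\lambda_i}-\mu_P\right\|\le\frac{\frac{\sqrt d}{2B}\sum_{i\le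 t}\psi_E(\lambda_i)\overline Z_i^2+4B\sqrt d+2B\sqrt d\,\log\frac1\alpha}{\frac23\sum_{i\le t}\lambda_i}+\frac{2B\sqrt d\,t\,\log(1+e^2\varepsilon)}{\frac23\sum_{i\le t}\lambda_i}.$$ (ii) For every $\alpha\in(0,1/e]$, with probability at least $1-\alpha$, simultaneously for all $t\ge1$, $$\left\|\frac{\sum_{i\le t}\lambda_iX_i}{\sum_{i\le t}\lambda_i}-\mu_P\right\|\le\frac{\frac{\sqrt d}{2B}\sum_{i\le t}\psi_E(\lambda_i)\overline Z_i^2+6B\sqrt d\,\log\frac1\alpha}{\frac23\sum_{i\le t}\lambda_i}+\frac{2B\sqrt d\,t\,\log(1+e^2\varepsilon)}{\frac23\sum_{i\le t}\lambda_i}.$$ -/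

import Mathlib

open MeasureTheory ProbabilityTheory

noncomputable section

/-- Total variation distance `sup_A |P(A) - Q(A)|`, over all measurable sets `A`. -/
def tvDist {𝓧 : Type*} [MeasurableSpace 𝓧] (P Q : Measure 𝓧) : ℝ :=
  ⨆ A : {A : Set 𝓧 // MeasurableSet A}, |P.real A.1 - Q.real A.1|

/-- The total variation ball of radius `ε` around `P`: all probability measures `Q` with
`tvDist P Q ≤ ε`. -/
def tvBall {𝓧 : Type*} [MeasurableSpace 𝓧] (P : Measure 𝓧) (ε : ℝ) : Set (Measure 𝓧) :=
  {Q | IsProbabilityMeasure Q ∧ tvDist P Q ≤ ε}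

/-- The function `ψ_E(l) = |log (1 - l) + l|`, used for `l` in `[0, 1)`. -/
def psiE (l : ℝ) : ℝ := |Real.log (1 - l) + l|

/-! Sequences that are indexed by `1, 2, 3, …` in the mathematics are indexed by `0, 1, 2, …` here:
`X i` is the observation number `i + 1`, and `lam i` is the weight number `i + 1`. -/

/-- The σ-algebra generated by the first `t` observations `X 0, …, X (t - 1)`
(trivial for `t = 0`). -/
abbrev sigmaFirst {Ω E : Type*} [MeasurableSpace E] (X : ℕ → Ω → E) (t : ℕ) : MeasurableSpace Ω :=
  ⨆ i ∈ Finset.range t, MeasurableSpace.comap (X i) inferInstance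

/-- Predictability: the weight that multiplies the observation `X i` is a measurable function of the
observations `X 0, …, X (i - 1)` that precede it. -/
def PredictableWeights {Ω E : Type*} [MeasurableSpace E] (X : ℕ → Ω → E) (lam : ℕ → Ω → ℝ) : Prop :=
  ∀ i, Measurable[sigmaFirst X i] (lam i)

/-- The mean of the first `t` observations `X 0, …, X (t - 1)`; it is `0` for `t = 0`. -/
def empMean {Ω E : Type*} [AddCommGroup E] [Module ℝ E] (X : ℕ → Ω → E) (t : ℕ) (ω : Ω) : E :=
  (t : ℝ)⁻¹ • ∑ i ∈ Finset.range t, X i ω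

/-- The distance from the observation `X i` to the mean of the observations that precede it. -/
def predResidual {Ω E : Type*} [NormedAddCommGroup E] [NormedSpace ℝ E] (X : ℕ → Ω → E) (i : ℕ) (ω : Ω) :
    ℝ :=
  ‖X i ω - empMean X i ω‖

/-- The weighted mean of the first `t` observations with the weights `lam`. -/
def weightedMean {Ω E : Type*} [AddCommGroup E] [Module ℝ E] (lam : ℕ → Ω → ℝ) (X : ℕ → Ω → E)
    (t : ℕ) (ω : Ω) : E :=
  (∑ i ∈ Finset.range t, lam i ω)⁻¹ • ∑ i ∈ Finset.range t, lam i ω • X i ω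

end

open scoped ENNReal RealInnerProductSpace

/-! For a direction `v` with `‖v‖ * (2 * B) ≤ 1`, Fan's inequality makes `exp (l⟪v, x - c⟫ - psiE l
* ⟪v, x - m⟫²)` have mean at most 1 under `P`, where `c` is the mean of `P` and `m` any prediction
in the ball. The factor is bounded on the ball, so passing from `P` to `Q` adds at most `exp 2 * ε`
to its mean. Dividing each factor by `C = 1 + exp 2 * ε` thus gives a nonnegative supermartingale
under `Q`; the total price is `t * log C`.

To pass from directions to the norm, average these supermartingales over the `2 ^ d` vectors with
coordinates `± 1 / (2B√d)` and apply Ville's inequality once. Off the bad event, change measure from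
uniform signs to independent signs with mean vector `x`, the unit vector along `S = ∑ lam i • (X i -
c)`. By Jensen and `1 + u ≤ exp u` this costs `∑ x j ^ 2 ≤ 1`, whatever the dimension, and the
linear term averages to `‖S‖ / (2B√d)`. Solving for `‖S‖` gives a bound stronger than the stated
one. -/

/-! ### Fan's inequality and total variation -/

/-- Fan's inequality. -/
theorem exp_mul_sub_psiE_mul_sq_le {l x : ℝ} (hl0 : 0 ≤ l) (hl1 : l < 1) (hx : |x| ≤ 1) :
    Real.exp (l * x - psiE l * x ^ 2) ≤ 1 + l * x := by
  have hz : |-(l * x)| < 1 := by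
    rw [abs_neg, abs_mul, abs_of_nonneg hl0]
    nlinarith [abs_nonneg x]
  have hl : |l| < 1 := by rwa [abs_of_nonneg hl0]
  have h1 := (hasSum_nat_add_iff' 1).2 (Real.hasSum_pow_div_log_of_abs_lt_one hz)
  have h2 := (hasSum_nat_add_iff' 1).2 (Real.hasSum_pow_div_log_of_abs_lt_one hl)
  simp only [Finset.range_one, Finset.sum_singleton, Nat.cast_zero, zero_add, pow_one,
    div_one] at h1 h2
  -- Compare termwise the series `∑ z ^ k / k`, `k ≥ 2`, of `-log (1 - z) - z` at `z = -(l * x)`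
  -- with `x ^ 2` times the one at `z = l`; `|x| ≤ 1` gives `|x| ^ k ≤ x ^ 2`.
  have key := hasSum_le (fun n => ?_) h1 (h2.mul_left (x ^ 2))
  · have hpsi : -Real.log (1 - l) - l = psiE l := by
      have h0 : Real.log (1 - l) ≤ -l := by
        have := Real.log_le_sub_one_of_pos (sub_pos.2 hl1)
        linarith
      rw [psiE, abs_of_nonpos (by linarith)]
      ring
    rw [hpsi] at key
    have hpos : 0 < 1 + l * x := by
      have := (abs_lt.1 hz).2
      linarith
    rw [← Real.le_log_iff_exp_le hpos]
    rw [show 1 - -(l * x) = 1 + l * x by ring] at key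
    linarith
  · rw [← mul_div_assoc]
    gcongr
    calc (-(l * x)) ^ (n + 1 + 1) ≤ |(-(l * x)) ^ (n + 1 + 1)| := le_abs_self _
      _ = |x| ^ n * (x ^ 2 * l ^ (n + 1 + 1)) := by
        rw [abs_pow, abs_neg, abs_mul, abs_of_nonneg hl0, ← sq_abs x]
        ring
      _ ≤ 1 * (x ^ 2 * l ^ (n + 1 + 1)) := by
        gcongr
        exact pow_le_one₀ (abs_nonneg _) hx
      _ = _ := one_mul _

theorem abs_measureReal_sub_le_tvDist {𝓧 : Type*} [MeasurableSpace 𝓧] (P Q : Measure 𝓧)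
    [IsProbabilityMeasure P] [IsProbabilityMeasure Q] {A : Set 𝓧} (hA : MeasurableSet A) :
    |P.real A - Q.real A| ≤ tvDist P Q := by
  refine le_ciSup (f := fun A : {A : Set 𝓧 // MeasurableSet A} => |P.real A.1 - Q.real A.1|)
    ⟨1, ?_⟩ ⟨A, hA⟩
  rintro _ ⟨A, rfl⟩
  have h1 := measureReal_le_one (μ := P) (s := A.1)
  have h2 := measureReal_le_one (μ := Q) (s := A.1)
  have h3 := measureReal_nonneg (μ := P) (s := A.1)
  have h4 := measureReal_nonneg (μ := Q) (s := A.1)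
  exact abs_le.2 ⟨by linarith, by linarith⟩

/-- Layer cake: the tails `{s < f}` differ in probability by at most `ε` for `s ≤ K`, and are
`Q`-null for `s > K`. -/
theorem lintegral_le_lintegral_add_of_mem_tvBall {𝓧 : Type*} [MeasurableSpace 𝓧]
    {P Q : Measure 𝓧} [IsProbabilityMeasure P] {ε : ℝ} (hQ : Q ∈ tvBall P ε) {f : 𝓧 → ℝ}
    (hf : Measurable f) (hf0 : ∀ x, 0 ≤ f x) {K : ℝ} (hK : 0 ≤ K) (hfK : ∀ᵐ x ∂Q, f x ≤ K) :
    ∫⁻ x, ENNReal.ofReal (f x) ∂Q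
      ≤ ∫⁻ x, ENNReal.ofReal (f x) ∂P + ENNReal.ofReal (K * ε) := by
  obtain ⟨hQ1, hQε⟩ := hQ
  rw [lintegral_eq_lintegral_meas_lt Q (.of_forall hf0) hf.aemeasurable,
    lintegral_eq_lintegral_meas_lt P (.of_forall hf0) hf.aemeasurable]
  have hset : ∀ s, MeasurableSet {x | s < f x} := fun s => measurableSet_lt measurable_const hf
  have hbound : ∀ s ∈ Set.Ioi (0 : ℝ), Q {x | s < f x}
      ≤ P {x | s < f x} + (Set.Ioc 0 K).indicator (fun _ => ENNReal.ofReal ε) s := by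
    intro s hs
    by_cases hsK : s ≤ K
    · rw [Set.indicator_of_mem (show s ∈ Set.Ioc 0 K from ⟨hs, hsK⟩)]
      have h := (abs_le.1 ((abs_measureReal_sub_le_tvDist P Q (hset s)).trans hQε)).1
      rw [← ofReal_measureReal (μ := Q), ← ofReal_measureReal (μ := P)]
      refine (ENNReal.ofReal_le_ofReal ?_).trans ENNReal.ofReal_add_le
      linarith
    · have : Q {x | s < f x} = 0 := by
        refine measure_mono_null ?_ hfK
        intro x hx
        simp only [Set.mem_ofPred_eq] at hx
        simp only [Set.mem_compl_iff, Set.mem_ofPred_eq, not_le]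
        exact (not_le.1 hsK).trans hx
      rw [this]
      exact zero_le
  refine (setLIntegral_mono' measurableSet_Ioi hbound).trans ?_
  rw [lintegral_add_right _ (measurable_const.indicator measurableSet_Ioc)]
  gcongr
  refine (setLIntegral_le_lintegral _ _).trans ?_
  rw [lintegral_indicator measurableSet_Ioc, setLIntegral_const, Real.volume_Ioc, sub_zero,
    mul_comm, ENNReal.ofReal_mul hK]

/-! ### Ville's inequality -/

/-- Ville's inequality, for a process whose integrals over past events do not increase. -/
theorem ville_inequality {Ω : Type*} {m : MeasurableSpace Ω} {μ : Measure Ω}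
    (ℱ : Filtration ℕ m) {M : ℕ → Ω → ℝ≥0∞} (hM : ∀ n, Measurable[ℱ n] (M n))
    (hsup : ∀ n A, MeasurableSet[ℱ n] A → ∫⁻ ω in A, M (n + 1) ω ∂μ ≤ ∫⁻ ω in A, M n ω ∂μ)
    (c : ℝ≥0∞) :
    c * μ {ω | ∃ n, c ≤ M n ω} ≤ ∫⁻ ω, M 0 ω ∂μ := by
  set A : ℕ → Set Ω := fun n => {ω | ∃ k ≤ n, c ≤ M k ω} with hAdef
  have hMm : ∀ n, Measurable (M n) := fun n => (hM n).mono (ℱ.le n) le_rfl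
  have hev : ∀ k n, k ≤ n → MeasurableSet[ℱ n] {ω | c ≤ M k ω} := fun k n hkn =>
    ℱ.mono hkn _ (hM k measurableSet_Ici)
  have hA : ∀ n, MeasurableSet[ℱ n] (A n) := by
    intro n
    have : A n = ⋃ k ∈ Set.Iic n, {ω | c ≤ M k ω} := by
      ext ω
      simp [hAdef]
    rw [this]
    exact MeasurableSet.biUnion (Set.to_countable _) fun k hk => hev k n hk
  have hAm : ∀ n, MeasurableSet (A n) := fun n => ℱ.le n _ (hA n)
  have hfirst : ∀ S : Set Ω, MeasurableSet S → ∀ n, ∫⁻ ω in S, M n ω ∂μ ≥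
      c * μ (S ∩ {ω | c ≤ M n ω}) + ∫⁻ ω in S \ {ω | c ≤ M n ω}, M n ω ∂μ := by
    intro S _ n
    have hE : MeasurableSet {ω | c ≤ M n ω} := hMm n measurableSet_Ici
    rw [← lintegral_inter_add_sdiff (M n) S hE, ge_iff_le]
    gcongr
    rw [← setLIntegral_const]
    exact setLIntegral_mono (hMm n) fun ω hω => hω.2
  -- Optional stopping at the first crossing of `c`: mass that has crossed counts as `c`, the rest
  -- still evolves and does not increase on the past event `(A n)ᶜ`.
  have hind : ∀ n, c * μ (A n) + ∫⁻ ω in (A n)ᶜ, M n ω ∂μ ≤ ∫⁻ ω, M 0 ω ∂μ := by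
    intro n
    induction n with
    | zero =>
      have h := hfirst Set.univ .univ 0
      have h0 : A 0 = {ω | c ≤ M 0 ω} := by
        ext ω
        simp [hAdef]
      rw [h0]
      simpa [Set.compl_eq_univ_sdiff] using h
    | succ n ih =>
      refine le_trans ?_ ih
      have h := (hfirst (A n)ᶜ (hAm n).compl (n + 1)).le.trans
        (hsup n (A n)ᶜ (hA n).compl)
      have hsplit : A (n + 1) = A n ∪ ((A n)ᶜ ∩ {ω | c ≤ M (n + 1) ω}) := by
        ext ω
        simp only [hAdef, Set.mem_ofPred_eq, Set.mem_union, Set.mem_inter_iff, Set.mem_compl_iff,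
          Nat.le_succ_iff]
        grind
      have hcompl : (A (n + 1))ᶜ = (A n)ᶜ \ {ω | c ≤ M (n + 1) ω} := by
        rw [hsplit]
        ext ω
        simp only [Set.mem_compl_iff, Set.mem_union, Set.mem_inter_iff, Set.mem_sdiff]
        tauto
      have hle : μ (A (n + 1)) ≤ μ (A n) + μ ((A n)ᶜ ∩ {ω | c ≤ M (n + 1) ω}) := by
        rw [hsplit]
        exact measure_union_le _ _
      calc c * μ (A (n + 1)) + ∫⁻ ω in (A (n + 1))ᶜ, M (n + 1) ω ∂μ
          ≤ c * (μ (A n) + μ ((A n)ᶜ ∩ {ω | c ≤ M (n + 1) ω}))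
            + ∫⁻ ω in (A n)ᶜ \ {ω | c ≤ M (n + 1) ω}, M (n + 1) ω ∂μ := by
            rw [← hcompl]
            gcongr
        _ = c * μ (A n) + (c * μ ((A n)ᶜ ∩ {ω | c ≤ M (n + 1) ω})
            + ∫⁻ ω in (A n)ᶜ \ {ω | c ≤ M (n + 1) ω}, M (n + 1) ω ∂μ) := by ring
        _ ≤ _ := by gcongr
  have hUnion : {ω | ∃ n, c ≤ M n ω} = ⋃ n, A n := by
    ext ω
    simp only [hAdef, Set.mem_ofPred_eq, Set.mem_iUnion]
    exact ⟨fun ⟨n, h⟩ => ⟨n, n, le_rfl, h⟩, fun ⟨_, k, _, h⟩ => ⟨k, h⟩⟩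
  have hmono : Monotone A := fun a b hab ω ⟨k, hk, h⟩ => ⟨k, hk.trans hab, h⟩
  rw [hUnion, hmono.measure_iUnion, ENNReal.mul_iSup]
  exact iSup_le fun n => le_self_add.trans (hind n)

/-! ### One-step bounds under `P` and `Q` -/

section

variable {E : Type*} [NormedAddCommGroup E] [InnerProductSpace ℝ E]

theorem abs_inner_sub_le_one {B : ℝ} {v x y : E} (hv : ‖v‖ * (2 * B) ≤ 1)
    (hx : ‖x‖ ≤ B) (hy : ‖y‖ ≤ B) : |⟪v, x - y⟫| ≤ 1 := by
  refine (abs_real_inner_le_norm _ _).trans (le_trans ?_ hv)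
  gcongr
  linarith [norm_sub_le x y]

/-- The factor contributed by an observation `x` with weight `l` and predicted value `m` to the
empirical Bernstein process in direction `v` for the mean `c`. -/
noncomputable def bernsteinFactor (v c : E) (l : ℝ) (m x : E) : ℝ :=
  Real.exp (l * ⟪v, x - c⟫ - psiE l * ⟪v, x - m⟫ ^ 2)

variable [MeasurableSpace E] [BorelSpace E] [SecondCountableTopology E]

theorem measurable_psiE : Measurable psiE := by
  unfold psiE
  fun_prop

theorem measurable_bernsteinFactor (v c : E) :
    Measurable fun p : ℝ × E × E => bernsteinFactor v c p.1 p.2.1 p.2.2 := by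
  unfold bernsteinFactor
  have := measurable_psiE
  fun_prop

variable [CompleteSpace E]

/-- Recentring at `m` pulls out `exp (-u)` with `u = l * ⟪v, c - m⟫`; Fan's inequality bounds what
remains by a function affine in `x`, of mean `1 + u ≤ exp u`. -/
theorem lintegral_bernsteinFactor_le_one {P : Measure E} [IsProbabilityMeasure P] {B : ℝ}
    (hPB : ∀ᵐ x ∂P, ‖x‖ ≤ B) {v m : E} (hv : ‖v‖ * (2 * B) ≤ 1) (hm : ‖m‖ ≤ B) {l : ℝ}
    (hl0 : 0 ≤ l) (hl1 : l < 1) :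
    ∫⁻ x, ENNReal.ofReal (bernsteinFactor v (∫ x, x ∂P) l m x) ∂P ≤ 1 := by
  set c := ∫ x, x ∂P
  have hint : Integrable (fun x : E => x) P :=
    Integrable.of_bound measurable_id.aestronglyMeasurable B hPB
  have hintm : Integrable (fun x : E => ⟪v, x - m⟫) P :=
    (hint.sub (integrable_const m)).const_inner v
  have hle : ∀ᵐ x ∂P, bernsteinFactor v c l m x
      ≤ Real.exp (-(l * ⟪v, c - m⟫)) * (1 + l * ⟪v, x - m⟫) := by
    filter_upwards [hPB] with x hx
    have h := exp_mul_sub_psiE_mul_sq_le hl0 hl1 (abs_inner_sub_le_one hv hx hm)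
    calc bernsteinFactor v c l m x = Real.exp (-(l * ⟪v, c - m⟫))
          * Real.exp (l * ⟪v, x - m⟫ - psiE l * ⟪v, x - m⟫ ^ 2) := by
          rw [← Real.exp_add, bernsteinFactor]
          congr 1
          simp only [inner_sub_right]
          ring
      _ ≤ _ := by gcongr
  have hnn : ∀ᵐ x ∂P, 0 ≤ Real.exp (-(l * ⟪v, c - m⟫)) * (1 + l * ⟪v, x - m⟫) := by
    filter_upwards [hle] with x hx using (Real.exp_pos _).le.trans hx
  have hintg : Integrable
      (fun x => Real.exp (-(l * ⟪v, c - m⟫)) * (1 + l * ⟪v, x - m⟫)) P :=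
    ((integrable_const _).add (hintm.const_mul l)).const_mul _
  calc ∫⁻ x, ENNReal.ofReal (bernsteinFactor v c l m x) ∂P
      ≤ ∫⁻ x, ENNReal.ofReal
          (Real.exp (-(l * ⟪v, c - m⟫)) * (1 + l * ⟪v, x - m⟫)) ∂P :=
        lintegral_mono_ae (hle.mono fun x hx => ENNReal.ofReal_le_ofReal hx)
    _ = ENNReal.ofReal (Real.exp (-(l * ⟪v, c - m⟫)) * (1 + l * ⟪v, c - m⟫)) := by
        rw [← ofReal_integral_eq_lintegral_ofReal hintg hnn, integral_const_mul,
          integral_add (integrable_const _) (hintm.const_mul l), integral_const_mul,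
          integral_inner (f := fun x => x - m) (hint.sub (integrable_const m)),
          integral_sub hint (integrable_const m)]
        simp [c]
    _ ≤ 1 := by
        rw [ENNReal.ofReal_le_one, Real.exp_neg, inv_mul_le_one₀ (Real.exp_pos _), add_comm]
        exact Real.add_one_le_exp _

theorem lintegral_bernsteinFactor_le_of_mem_tvBall {P Q : Measure E} [IsProbabilityMeasure P]
    {B ε : ℝ} (hPB : ∀ᵐ x ∂P, ‖x‖ ≤ B) (hQ : Q ∈ tvBall P ε) (hε : 0 ≤ ε)
    (hQB : ∀ᵐ x ∂Q, ‖x‖ ≤ B) {v m : E} (hv : ‖v‖ * (2 * B) ≤ 1) (hm : ‖m‖ ≤ B) {l : ℝ}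
    (hl0 : 0 ≤ l) (hl1 : l < 1) :
    ∫⁻ x, ENNReal.ofReal (bernsteinFactor v (∫ x, x ∂P) l m x) ∂Q
      ≤ ENNReal.ofReal (1 + Real.exp 2 * ε) := by
  have hc : ‖∫ x, x ∂P‖ ≤ B := by
    simpa using norm_integral_le_of_norm_le_const hPB
  have hmeas : Measurable fun x => bernsteinFactor v (∫ x, x ∂P) l m x :=
    (measurable_bernsteinFactor v (∫ x, x ∂P)).comp
      (measurable_const.prodMk (measurable_const.prodMk measurable_id))
  refine (lintegral_le_lintegral_add_of_mem_tvBall hQ hmeas (fun x => (Real.exp_pos _).le)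
    (Real.exp_pos 2).le ?_).trans ?_
  -- The exponent is at most `l < 1`, so the ceiling `exp 2` has room to spare.
  · filter_upwards [hQB] with x hx
    refine Real.exp_le_exp.2 ?_
    have h1 := (abs_le.1 (abs_inner_sub_le_one hv hx hc)).2
    have h2 : 0 ≤ psiE l * ⟪v, x - m⟫ ^ 2 := mul_nonneg (abs_nonneg _) (sq_nonneg _)
    nlinarith
  · rw [ENNReal.ofReal_add zero_le_one (by positivity), ENNReal.ofReal_one]
    gcongr
    exact lintegral_bernsteinFactor_le_one hPB hv hm hl0 hl1

end

/-! ### Independence of past and present -/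

theorem IndepFun.lintegral_comp_prodMk {Ω F G : Type*} [MeasurableSpace Ω] [MeasurableSpace F]
    [MeasurableSpace G] {μ : Measure Ω} [IsProbabilityMeasure μ] {Y : Ω → F} {X : Ω → G}
    (h : IndepFun Y X μ) (hY : Measurable Y) (hX : Measurable X) {Φ : F × G → ℝ≥0∞}
    (hΦ : Measurable Φ) :
    ∫⁻ ω, Φ (Y ω, X ω) ∂μ = ∫⁻ ω, ∫⁻ x, Φ (Y ω, x) ∂(μ.map X) ∂μ := by
  have := Measure.isProbabilityMeasure_map (μ := μ) hY.aemeasurable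
  have := Measure.isProbabilityMeasure_map (μ := μ) hX.aemeasurable
  rw [← lintegral_map hΦ (hY.prodMk hX),
    (indepFun_iff_map_prod_eq_prod_map_map hY.aemeasurable hX.aemeasurable).1 h,
    lintegral_prod _ hΦ.aemeasurable, lintegral_map (hΦ.lintegral_prod_right') hY]

section

variable {Ω E : Type*} {mΩ : MeasurableSpace Ω} [MeasurableSpace E]

/-- The filtration generated by the observations that precede each time. -/
def sigmaFirstFiltration {X : ℕ → Ω → E} (hX : ∀ i, Measurable (X i)) : Filtration ℕ mΩ where
  seq := sigmaFirst X
  mono' _ _ h := biSup_mono fun _ hi => Finset.range_mono h hi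
  le' _ := iSup₂_le fun i _ => (hX i).comap_le

theorem measurable_sigmaFirst {X : ℕ → Ω → E} {i n : ℕ} (h : i < n) :
    Measurable[sigmaFirst X n] (X i) :=
  (comap_measurable (X i)).mono
    (le_iSup₂_of_le (f := fun i (_ : i ∈ Finset.range n) => MeasurableSpace.comap (X i) inferInstance)
      i (Finset.mem_range.2 h) le_rfl) le_rfl

theorem iIndepFun.indepFun_of_measurable_sigmaFirst {μ : Measure Ω} {X : ℕ → Ω → E}
    (hX : ∀ i, Measurable (X i)) (hindep : iIndepFun X μ) {F : Type*} [MeasurableSpace F]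
    {n : ℕ} {Y : Ω → F} (hY : Measurable[sigmaFirst X n] Y) : IndepFun Y (X n) μ := by
  have h := indep_iSup_of_disjoint (fun i => (hX i).comap_le) hindep.iIndep
    (S := ↑(Finset.range n)) (T := {n}) (by simp)
  simp only [Set.mem_singleton_iff, iSup_iSup_eq_left, Finset.mem_coe] at h
  exact indep_of_indep_of_le_left h hY.comap_le

end

/-! ### The supermartingale and its mixtures -/

section

variable {Ω E : Type*} {mΩ : MeasurableSpace Ω} [NormedAddCommGroup E] [InnerProductSpace ℝ E]

/-- The product of the first `n` empirical Bernstein factors, normalised by the constant `C`. -/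
noncomputable def bernsteinProcess (v c : E) (C : ℝ) (lam : ℕ → Ω → ℝ) (X : ℕ → Ω → E) (n : ℕ)
    (ω : Ω) : ℝ :=
  ∏ i ∈ Finset.range n, bernsteinFactor v c (lam i ω) (empMean X i ω) (X i ω) / C

theorem bernsteinProcess_nonneg (v c : E) {C : ℝ} (hC : 0 ≤ C) (lam : ℕ → Ω → ℝ) (X : ℕ → Ω → E)
    (n : ℕ) (ω : Ω) : 0 ≤ bernsteinProcess v c C lam X n ω :=
  Finset.prod_nonneg fun _ _ => div_nonneg (Real.exp_pos _).le hC

theorem norm_empMean_le {X : ℕ → Ω → E} {B : ℝ} (hB : 0 ≤ B) {ω : Ω} (h : ∀ i, ‖X i ω‖ ≤ B)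
    (n : ℕ) : ‖empMean X n ω‖ ≤ B := by
  rw [empMean, norm_smul, norm_inv, Real.norm_natCast]
  rcases n.eq_zero_or_pos with rfl | hn
  · simpa using hB
  · rw [inv_mul_le_iff₀ (by positivity)]
    simpa using norm_sum_le_of_le (Finset.range n) fun i _ => h i

variable [MeasurableSpace E] [BorelSpace E] [SecondCountableTopology E]

theorem measurable_empMean (X : ℕ → Ω → E) (n : ℕ) : Measurable[sigmaFirst X n] (empMean X n) := by
  unfold empMean
  refine Measurable.const_smul (m := sigmaFirst X n) (Finset.measurable_fun_sum _ fun i hi => ?_) _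
  exact measurable_sigmaFirst (Finset.mem_range.1 hi)

theorem measurable_bernsteinProcess (v c : E) (C : ℝ) {lam : ℕ → Ω → ℝ} {X : ℕ → Ω → E}
    (hpred : PredictableWeights X lam) (n : ℕ) :
    Measurable[sigmaFirst X n] (bernsteinProcess v c C lam X n) := by
  have hmono : ∀ i ∈ Finset.range n, sigmaFirst X i ≤ sigmaFirst X n := fun i hi =>
    biSup_mono fun _ h => Finset.range_mono (Finset.mem_range.1 hi).le h
  unfold bernsteinProcess
  refine Finset.measurable_fun_prod _ fun i hi => ?_
  refine Measurable.div_const (m := sigmaFirst X n) ?_ _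
  exact (measurable_bernsteinFactor v c).comp
    (((hpred i).mono (hmono i hi) le_rfl).prodMk
      (((measurable_empMean X i).mono (hmono i hi) le_rfl).prodMk
        (measurable_sigmaFirst (Finset.mem_range.1 hi))))

/-- Integrating over past events replaces conditional expectation. `hstep` is only almost sure
because the past mean lies in the ball only almost surely. -/
theorem setLIntegral_bernsteinProcess_succ_le {μ : Measure Ω} [IsProbabilityMeasure μ]
    {Q : Measure E} {X : ℕ → Ω → E} (hX : ∀ i, Measurable (X i))
    (hlaw : ∀ i, μ.map (X i) = Q) (hindep : iIndepFun X μ) {lam : ℕ → Ω → ℝ}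
    (hpred : PredictableWeights X lam) {v c : E} {C : ℝ} (hC : 0 < C)
    (hstep : ∀ i, ∀ᵐ ω ∂μ, ∫⁻ x, ENNReal.ofReal
      (bernsteinFactor v c (lam i ω) (empMean X i ω) x) ∂Q ≤ ENNReal.ofReal C)
    (n : ℕ) {A : Set Ω} (hA : MeasurableSet[sigmaFirst X n] A) :
    ∫⁻ ω in A, ENNReal.ofReal (bernsteinProcess v c C lam X (n + 1) ω) ∂μ
      ≤ ∫⁻ ω in A, ENNReal.ofReal (bernsteinProcess v c C lam X n ω) ∂μ := by
  have hle : sigmaFirst X n ≤ mΩ := (sigmaFirstFiltration hX).le n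
  set g : Ω → ℝ≥0∞ := A.indicator fun ω => ENNReal.ofReal (bernsteinProcess v c C lam X n ω)
  have hg : Measurable[sigmaFirst X n] g :=
    (measurable_bernsteinProcess v c C hpred n).ennreal_ofReal.indicator hA
  -- All the past that enters the next step, bundled so that it is independent of `X n` and Fubini
  -- applies.
  set Y : Ω → ℝ≥0∞ × ℝ × E := fun ω => (g ω, lam n ω, empMean X n ω)
  have hY : Measurable[sigmaFirst X n] Y := hg.prodMk ((hpred n).prodMk (measurable_empMean X n))
  set Φ : (ℝ≥0∞ × ℝ × E) × E → ℝ≥0∞ := fun p =>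
    p.1.1 * ENNReal.ofReal (bernsteinFactor v c p.1.2.1 p.1.2.2 p.2 / C)
  have hfac : Measurable fun p : (ℝ≥0∞ × ℝ × E) × E => bernsteinFactor v c p.1.2.1 p.1.2.2 p.2 :=
    (measurable_bernsteinFactor v c).comp (by fun_prop :
      Measurable fun p : (ℝ≥0∞ × ℝ × E) × E => (p.1.2.1, p.1.2.2, p.2))
  have hΦ : Measurable Φ := by fun_prop
  have hind := iIndepFun.indepFun_of_measurable_sigmaFirst hX hindep hY
  rw [← lintegral_indicator (hle _ hA), ← lintegral_indicator (hle _ hA)]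
  calc ∫⁻ ω, A.indicator
        (fun ω => ENNReal.ofReal (bernsteinProcess v c C lam X (n + 1) ω)) ω ∂μ
      = ∫⁻ ω, Φ (Y ω, X n ω) ∂μ := by
        refine lintegral_congr fun ω => ?_
        by_cases hω : ω ∈ A
        · simp only [Φ, Y, g, Set.indicator_of_mem hω]
          rw [← ENNReal.ofReal_mul (bernsteinProcess_nonneg v c hC.le lam X n ω),
            bernsteinProcess, Finset.prod_range_succ, bernsteinProcess]
        · simp [Φ, Y, g, hω]
    _ = ∫⁻ ω, ∫⁻ x, Φ (Y ω, x) ∂Q ∂μ := by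
        rw [IndepFun.lintegral_comp_prodMk hind (hY.mono hle le_rfl) (hX n) hΦ, hlaw n]
    _ ≤ ∫⁻ ω, g ω ∂μ := by
        refine lintegral_mono_ae ?_
        filter_upwards [hstep n] with ω hω
        have hm : Measurable fun x =>
            ENNReal.ofReal (bernsteinFactor v c (lam n ω) (empMean X n ω) x) :=
          (hfac.comp (measurable_prodMk_left (x := Y ω))).ennreal_ofReal
        simp only [Φ, Y]
        simp only [ENNReal.ofReal_div_of_pos hC]
        simp only [div_eq_mul_inv]
        rw [lintegral_const_mul _ (hm.mul_const _)]
        refine mul_le_of_le_one_right' ?_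
        rw [lintegral_mul_const _ hm, ← div_eq_mul_inv]
        exact ENNReal.div_le_of_le_mul (by simpa using hω)

/-- Uniformly weighted finite mixtures of the processes exceed `1 / α` with probability at most
`α`. -/
theorem measure_exists_le_average_bernsteinProcess_le {μ : Measure Ω} [IsProbabilityMeasure μ]
    {Q : Measure E} {X : ℕ → Ω → E} (hX : ∀ i, Measurable (X i))
    (hlaw : ∀ i, μ.map (X i) = Q) (hindep : iIndepFun X μ) {lam : ℕ → Ω → ℝ}
    (hpred : PredictableWeights X lam) {ι : Type*} [Fintype ι] {v : ι → E} {c : E} {C : ℝ}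
    (hC : 0 < C)
    (hstep : ∀ s i, ∀ᵐ ω ∂μ, ∫⁻ x, ENNReal.ofReal
      (bernsteinFactor (v s) c (lam i ω) (empMean X i ω) x) ∂Q ≤ ENNReal.ofReal C)
    {p : ι → ℝ} (hp : ∀ s, 0 ≤ p s) (hp1 : ∑ s, p s = 1) {α : ℝ} (hα : 0 < α) :
    μ {ω | ∃ n, 1 / α ≤ ∑ s, p s * bernsteinProcess (v s) c C lam X n ω} ≤ ENNReal.ofReal α := by
  set M : ℕ → Ω → ℝ≥0∞ := fun n ω =>
    ∑ s, ENNReal.ofReal (p s) * ENNReal.ofReal (bernsteinProcess (v s) c C lam X n ω)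
  have hterm : ∀ n s, Measurable[sigmaFirst X n] fun ω =>
      ENNReal.ofReal (bernsteinProcess (v s) c C lam X n ω) := fun n s =>
    (measurable_bernsteinProcess (v s) c C hpred n).ennreal_ofReal
  have hle : ∀ n, sigmaFirst X n ≤ mΩ := (sigmaFirstFiltration hX).le
  have hterm' : ∀ n s, Measurable fun ω =>
      ENNReal.ofReal (bernsteinProcess (v s) c C lam X n ω) := fun n s =>
    (hterm n s).mono (hle n) le_rfl
  have hMeq : ∀ n ω, M n ω
      = ENNReal.ofReal (∑ s, p s * bernsteinProcess (v s) c C lam X n ω) := by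
    intro n ω
    rw [ENNReal.ofReal_sum_of_nonneg fun s _ =>
      mul_nonneg (hp s) (bernsteinProcess_nonneg (v s) c hC.le lam X n ω)]
    exact Finset.sum_congr rfl fun s _ => (ENNReal.ofReal_mul (hp s)).symm
  have hville := ville_inequality (μ := μ) (sigmaFirstFiltration hX) (M := M)
    (fun n => Finset.measurable_fun_sum _ fun s _ => (hterm n s).const_mul _)
    (fun n A hA => by
      simp only [M]
      rw [lintegral_finsetSum _ fun s _ => (hterm' (n + 1) s).const_mul _,
        lintegral_finsetSum _ fun s _ => (hterm' n s).const_mul _]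
      refine Finset.sum_le_sum fun s _ => ?_
      rw [lintegral_const_mul _ (hterm' (n + 1) s), lintegral_const_mul _ (hterm' n s)]
      refine mul_le_mul_right ?_ _
      exact setLIntegral_bernsteinProcess_succ_le hX hlaw hindep hpred hC (hstep s) n hA)
    (ENNReal.ofReal (1 / α))
  have h0 : ∫⁻ ω, M 0 ω ∂μ = 1 := by
    simp only [hMeq]
    simp [bernsteinProcess, hp1]
  rw [h0] at hville
  have hset : {ω | ∃ n, 1 / α ≤ ∑ s, p s * bernsteinProcess (v s) c C lam X n ω}
      ⊆ {ω | ∃ n, ENNReal.ofReal (1 / α) ≤ M n ω} := by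
    rintro ω ⟨n, hn⟩
    exact ⟨n, by rw [hMeq]; exact ENNReal.ofReal_le_ofReal hn⟩
  refine (measure_mono hset).trans ?_
  have hα' : ENNReal.ofReal α ≠ 0 := by simpa using hα
  rw [one_div, ENNReal.ofReal_inv_of_pos hα, ← ENNReal.div_eq_inv_mul] at hville
  rw [one_div, ENNReal.ofReal_inv_of_pos hα]
  simpa using (ENNReal.div_le_iff hα' ENNReal.ofReal_ne_top).1 hville

end

/-! ### Random signs and change of measure -/

section

variable {ι : Type*} [Fintype ι]

/-- The sign encoded by a Boolean. -/
def boolSign (b : Bool) : ℝ := if b then 1 else -1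

/-- The product distribution on sign vectors whose mean is `x`. -/
noncomputable def signWeight (x : ι → ℝ) (s : ι → Bool) : ℝ := ∏ j, (1 + boolSign (s j) * x j) / 2

theorem boolSign_sq (b : Bool) : boolSign b ^ 2 = 1 := by
  cases b <;> simp [boolSign]

theorem one_add_boolSign_mul_nonneg {x : ℝ} (hx : |x| ≤ 1) (b : Bool) :
    0 ≤ 1 + boolSign b * x := by
  have := abs_le.1 hx
  cases b <;> simp [boolSign] <;> linarith

theorem signWeight_nonneg {x : ι → ℝ} (hx : ∀ j, |x j| ≤ 1) (s : ι → Bool) :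
    0 ≤ signWeight x s :=
  Finset.prod_nonneg fun j _ => div_nonneg (one_add_boolSign_mul_nonneg (hx j) _) zero_le_two

theorem sum_signWeight [DecidableEq ι] (x : ι → ℝ) : ∑ s, signWeight x s = 1 := by
  have h := Finset.prod_univ_sum (fun _ : ι => (Finset.univ : Finset Bool))
    fun j b => (1 + boolSign b * x j) / 2
  rw [Fintype.piFinset_univ] at h
  simp only [signWeight]
  rw [← h]
  refine Finset.prod_eq_one fun j _ => ?_
  simp [boolSign]
  ring

theorem sum_signWeight_mul_boolSign [DecidableEq ι] (x : ι → ℝ) (k : ι) :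
    ∑ s, signWeight x s * boolSign (s k) = x k := by
  have h := Finset.prod_univ_sum (fun _ : ι => (Finset.univ : Finset Bool))
    fun j b => (1 + boolSign b * x j) / 2 * (if j = k then boolSign b else 1)
  rw [Fintype.piFinset_univ] at h
  have h2 : ∀ s : ι → Bool, signWeight x s * boolSign (s k)
      = ∏ j, (1 + boolSign (s j) * x j) / 2 * (if j = k then boolSign (s j) else 1) := by
    intro s
    rw [Finset.prod_mul_distrib, Finset.prod_ite_eq' Finset.univ k, if_pos (Finset.mem_univ k),
      signWeight]
  simp only [h2]
  rw [← h, Finset.prod_eq_single k]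
  · simp [boolSign]
    ring
  · intro j _ hj
    simp [hj, boolSign]
    ring
  · simp

/-- A change of measure from the uniform distribution on sign vectors to the product distribution
with mean `x`. -/
theorem exp_sum_signWeight_mul_sub_le [DecidableEq ι] {x : ι → ℝ} (hx : ∀ j, |x j| ≤ 1)
    (L : (ι → Bool) → ℝ) :
    Real.exp (∑ s, signWeight x s * L s - ∑ j, x j ^ 2)
      ≤ ∑ s, (1 / 2) ^ Fintype.card ι * Real.exp (L s) := by
  have hlin : ∑ s, signWeight x s * (L s - ∑ j, boolSign (s j) * x j)
      = ∑ s, signWeight x s * L s - ∑ j, x j ^ 2 := by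
    simp only [mul_sub, Finset.sum_sub_distrib, Finset.mul_sum]
    rw [Finset.sum_comm (s := Finset.univ (α := ι → Bool))]
    congr 1
    refine Finset.sum_congr rfl fun j _ => ?_
    simp only [← mul_assoc]
    rw [← Finset.sum_mul, sum_signWeight_mul_boolSign, sq]
  have hJensen := convexOn_exp.map_sum_le (t := Finset.univ) (w := signWeight x)
    (p := fun s => L s - ∑ j, boolSign (s j) * x j)
    (fun s _ => signWeight_nonneg hx s) (sum_signWeight x) (fun _ _ => Set.mem_univ _)
  simp only [smul_eq_mul] at hJensen
  rw [hlin] at hJensen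
  refine hJensen.trans (Finset.sum_le_sum fun s _ => ?_)
  -- Bounding the density `∏ (1 + s j * x j)` by an exponential replaces the relative entropy by `∑
  -- x j ^ 2`.
  have hw : signWeight x s
      ≤ (1 / 2) ^ Fintype.card ι * Real.exp (∑ j, boolSign (s j) * x j) := by
    rw [signWeight, Real.exp_sum, ← Finset.card_univ, ← Finset.prod_const,
      ← Finset.prod_mul_distrib]
    refine Finset.prod_le_prod (fun j _ =>
      div_nonneg (one_add_boolSign_mul_nonneg (hx j) _) zero_le_two) fun j _ => ?_
    have := Real.add_one_le_exp (boolSign (s j) * x j)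
    linarith
  calc signWeight x s * Real.exp (L s - ∑ j, boolSign (s j) * x j)
      ≤ (1 / 2) ^ Fintype.card ι * Real.exp (∑ j, boolSign (s j) * x j)
        * Real.exp (L s - ∑ j, boolSign (s j) * x j) := by gcongr
    _ = _ := by
      rw [mul_assoc, ← Real.exp_add]
      congr 2
      ring

/-- The vector with coordinates `± r⁻¹`. -/
noncomputable def signVector (r : ℝ) (s : ι → Bool) : EuclideanSpace ℝ ι :=
  WithLp.toLp 2 fun j => r⁻¹ * boolSign (s j)

theorem inner_signVector (r : ℝ) (s : ι → Bool) (y : EuclideanSpace ℝ ι) :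
    ⟪signVector r s, y⟫ = r⁻¹ * ∑ j, boolSign (s j) * y j := by
  simp only [PiLp.inner_apply, signVector, Finset.mul_sum, RCLike.inner_apply, conj_trivial]
  exact Finset.sum_congr rfl fun j _ => by ring

theorem norm_signVector {r : ℝ} (hr : 0 ≤ r) (s : ι → Bool) :
    ‖signVector r s‖ = √(Fintype.card ι) / r := by
  rw [EuclideanSpace.norm_eq]
  simp only [signVector, Real.norm_eq_abs, sq_abs, mul_pow, boolSign_sq, mul_one, inv_pow,
    Finset.sum_const, Finset.card_univ, nsmul_eq_mul]
  rw [← div_eq_mul_inv, Real.sqrt_div (by positivity), Real.sqrt_sq hr]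

/-- The witness is `y / ‖y‖`; for `y = 0` the convention `0⁻¹ = 0` makes it zero, which also works.
-/
theorem exists_norm_le_sum_signWeight (y : EuclideanSpace ℝ ι) [DecidableEq ι] {r : ℝ} :
    ∃ x : ι → ℝ, (∀ j, |x j| ≤ 1) ∧ ∑ j, x j ^ 2 ≤ 1 ∧
      ∑ s, signWeight x s * ⟪signVector r s, y⟫ = r⁻¹ * ‖y‖ := by
  have hsq : ∑ j, (‖y‖⁻¹ * y j) ^ 2 ≤ 1 := by
    simp only [mul_pow, ← Finset.mul_sum]
    rw [← EuclideanSpace.real_norm_sq_eq, ← mul_pow]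
    by_cases hy : ‖y‖ = 0
    · simp [hy]
    · simp [inv_mul_cancel₀ hy]
  refine ⟨fun j => ‖y‖⁻¹ * y j, fun j => ?_, hsq, ?_⟩
  · rw [← sq_le_one_iff_abs_le_one]
    exact (Finset.single_le_sum (f := fun j => (‖y‖⁻¹ * y j) ^ 2) (fun j _ => sq_nonneg _)
      (Finset.mem_univ j)).trans hsq
  · simp only [inner_signVector, Finset.mul_sum]
    rw [Finset.sum_comm]
    have : ∀ j, ∑ s, signWeight (fun j => ‖y‖⁻¹ * y j) s * (r⁻¹ * (boolSign (s j) * y j))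
        = r⁻¹ * (‖y‖⁻¹ * y j ^ 2) := by
      intro j
      rw [show r⁻¹ * (‖y‖⁻¹ * y j ^ 2) = (‖y‖⁻¹ * y j) * (r⁻¹ * y j) by ring,
        ← sum_signWeight_mul_boolSign (fun j => ‖y‖⁻¹ * y j) j, Finset.sum_mul]
      exact Finset.sum_congr rfl fun s _ => by ring
    simp only [this, ← Finset.mul_sum]
    rw [← EuclideanSpace.real_norm_sq_eq]
    by_cases hy : ‖y‖ = 0
    · simp [hy]
    · field_simp

end

/-! ### From the mixture to the norm -/

theorem bernsteinProcess_eq_exp {Ω E : Type*} [NormedAddCommGroup E] [InnerProductSpace ℝ E]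
    (v c : E) {C : ℝ} (hC : 0 < C) (lam : ℕ → Ω → ℝ) (X : ℕ → Ω → E) (n : ℕ) (ω : Ω) :
    bernsteinProcess v c C lam X n ω
      = Real.exp (⟪v, ∑ i ∈ Finset.range n, lam i ω • (X i ω - c)⟫
        - ∑ i ∈ Finset.range n, psiE (lam i ω) * ⟪v, X i ω - empMean X i ω⟫ ^ 2
        - n * Real.log C) := by
  rw [Real.exp_sub _ (n * Real.log C), Real.exp_nat_mul, Real.exp_log hC, inner_sum,
    ← Finset.sum_sub_distrib, Real.exp_sum]
  simp [bernsteinProcess, bernsteinFactor, Finset.prod_div_distrib, real_inner_smul_right]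

/-- The deterministic bound that holds where the average of the processes over sign vectors is
small. -/
theorem norm_sum_smul_sub_le_of_average_bernsteinProcess_lt {Ω ι : Type*} [Fintype ι] [Nonempty ι]
    [DecidableEq ι] {B : ℝ} (hB : 0 < B) {c : EuclideanSpace ℝ ι} {C : ℝ} (hC : 0 < C)
    {lam : ℕ → Ω → ℝ} {X : ℕ → Ω → EuclideanSpace ℝ ι} {n : ℕ} {ω : Ω} {α : ℝ} (hα : 0 < α)
    (h : ∑ s, (1 / 2) ^ Fintype.card ι * bernsteinProcess
      (signVector (2 * B * √(Fintype.card ι)) s) c C lam X n ω < 1 / α) :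
    ‖∑ i ∈ Finset.range n, lam i ω • (X i ω - c)‖
      ≤ √(Fintype.card ι) / (2 * B)
          * ∑ i ∈ Finset.range n, psiE (lam i ω) * predResidual X i ω ^ 2
        + 2 * B * √(Fintype.card ι) * (1 + Real.log (1 / α) + n * Real.log C) := by
  have hd : 0 < √(Fintype.card ι : ℝ) := Real.sqrt_pos.2 (by exact_mod_cast Fintype.card_pos)
  set r := 2 * B * √(Fintype.card ι : ℝ) with hr
  have hr0 : 0 < r := by positivity
  set S := ∑ i ∈ Finset.range n, lam i ω • (X i ω - c)
  obtain ⟨x, hx1, hx2, hx3⟩ := exists_norm_le_sum_signWeight S (r := r)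
  set D := ∑ i ∈ Finset.range n, psiE (lam i ω) * predResidual X i ω ^ 2 with hD
  -- Every sign vector has norm exactly `1 / (2B)`, so Cauchy–Schwarz bounds the quadratic term
  -- uniformly in `s`.
  have hquad : ∀ s, ∑ i ∈ Finset.range n,
      psiE (lam i ω) * ⟪signVector r s, X i ω - empMean X i ω⟫ ^ 2 ≤ (2 * B)⁻¹ ^ 2 * D := by
    intro s
    rw [hD, Finset.mul_sum]
    refine Finset.sum_le_sum fun i _ => ?_
    have hv : ‖signVector r s‖ = (2 * B)⁻¹ := by
      rw [norm_signVector hr0.le, hr]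
      field_simp
    have hin := abs_real_inner_le_norm (signVector r s) (X i ω - empMean X i ω)
    rw [hv] at hin
    have hpsi : 0 ≤ psiE (lam i ω) := abs_nonneg _
    calc psiE (lam i ω) * ⟪signVector r s, X i ω - empMean X i ω⟫ ^ 2
        ≤ psiE (lam i ω) * ((2 * B)⁻¹ * ‖X i ω - empMean X i ω‖) ^ 2 := by
          rw [← sq_abs]
          gcongr
      _ = _ := by
          rw [predResidual]
          ring
  simp only [bernsteinProcess_eq_exp _ c hC] at h
  have hlt := (exp_sum_signWeight_mul_sub_le hx1 _).trans_lt h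
  rw [← Real.lt_log_iff_exp_lt (by positivity)] at hlt
  have hlow : r⁻¹ * ‖S‖ - (2 * B)⁻¹ ^ 2 * D - n * Real.log C
      ≤ ∑ s, signWeight x s * (⟪signVector r s, S⟫
        - ∑ i ∈ Finset.range n, psiE (lam i ω) * ⟪signVector r s, X i ω - empMean X i ω⟫ ^ 2
        - n * Real.log C) := by
    have hconst : (2 * B)⁻¹ ^ 2 * D + n * Real.log C
        = ∑ s, signWeight x s * ((2 * B)⁻¹ ^ 2 * D + n * Real.log C) := by
      rw [← Finset.sum_mul, sum_signWeight, one_mul]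
    rw [← hx3, sub_sub, hconst, ← Finset.sum_sub_distrib]
    refine Finset.sum_le_sum fun s _ => ?_
    rw [← mul_sub]
    exact mul_le_mul_of_nonneg_left (by linarith [hquad s]) (signWeight_nonneg hx1 s)
  have hfin : r⁻¹ * ‖S‖ ≤ (2 * B)⁻¹ ^ 2 * D + (1 + Real.log (1 / α) + n * Real.log C) := by
    linarith
  calc ‖S‖ = r * (r⁻¹ * ‖S‖) := by rw [mul_inv_cancel_left₀ hr0.ne']
    _ ≤ r * ((2 * B)⁻¹ ^ 2 * D + (1 + Real.log (1 / α) + n * Real.log C)) := by gcongr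
    _ = _ := by
      rw [hr]
      field_simp

theorem weightedMean_sub_eq {Ω E : Type*} [AddCommGroup E] [Module ℝ E] {lam : ℕ → Ω → ℝ}
    {X : ℕ → Ω → E} {t : ℕ} {ω : Ω} (h : ∑ i ∈ Finset.range t, lam i ω ≠ 0) (c : E) :
    weightedMean lam X t ω - c
      = (∑ i ∈ Finset.range t, lam i ω)⁻¹ • ∑ i ∈ Finset.range t, lam i ω • (X i ω - c) := by
  simp only [smul_sub, Finset.sum_sub_distrib, ← Finset.sum_smul]
  rw [inv_smul_smul₀ h, weightedMean]

theorem measure_norm_weightedMean_sub_le {d : ℕ} {Ω : Type*} [MeasurableSpace Ω] (μ : Measure Ω)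
    [IsProbabilityMeasure μ] {B : ℝ} (hB : 0 < B)
    {P : Measure (EuclideanSpace ℝ (Fin d))} [IsProbabilityMeasure P]
    (hPB : ∀ᵐ x ∂P, ‖x‖ ≤ B) {ε : ℝ} (hε : 0 < ε)
    {Q : Measure (EuclideanSpace ℝ (Fin d))} (hQ : Q ∈ tvBall P ε) (hQB : ∀ᵐ x ∂Q, ‖x‖ ≤ B)
    {X : ℕ → Ω → EuclideanSpace ℝ (Fin d)} (hX : ∀ i, Measurable (X i))
    (hlaw : ∀ i, Measure.map (X i) μ = Q) (hindep : iIndepFun X μ)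
    {lam : ℕ → Ω → ℝ} (hlam : ∀ i ω, lam i ω ∈ Set.Ioc (0 : ℝ) 0.8)
    (hpred : PredictableWeights X lam) {α : ℝ} (hα : 0 < α) (hα1 : α < 1) :
    1 - α ≤ μ.real {ω | ∀ t : ℕ, 1 ≤ t →
      ‖weightedMean lam X t ω - ∫ x, x ∂P‖ ≤
        (√(d : ℝ) / (2 * B) * ∑ i ∈ Finset.range t, psiE (lam i ω) * predResidual X i ω ^ 2
            + 4 * B * √(d : ℝ) + 2 * B * √(d : ℝ) * Real.log (1 / α))
          / (2 / 3 * ∑ i ∈ Finset.range t, lam i ω)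
        + 2 * B * √(d : ℝ) * (t : ℝ) * Real.log (1 + Real.exp 2 * ε)
          / (2 / 3 * ∑ i ∈ Finset.range t, lam i ω)} := by
  rcases d.eq_zero_or_pos with rfl | hd
  · have : ∀ t ω, weightedMean lam X t ω - ∫ x, x ∂P = 0 := fun t ω => Subsingleton.elim _ _
    simp [this, hα.le]
  have : Nonempty (Fin d) := ⟨⟨0, hd⟩⟩
  have hdpos : 0 < √(d : ℝ) := Real.sqrt_pos.2 (by exact_mod_cast hd)
  set C := 1 + Real.exp 2 * ε with hCdef
  have hC1 : 1 ≤ C := le_add_of_nonneg_right (by positivity)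
  have hC : 0 < C := zero_lt_one.trans_le hC1
  set c := ∫ x, x ∂P with hc
  set v : (Fin d → Bool) → EuclideanSpace ℝ (Fin d) :=
    signVector (2 * B * √(Fintype.card (Fin d)))
  have hv : ∀ s, ‖v s‖ * (2 * B) ≤ 1 := by
    intro s
    rw [norm_signVector (by positivity), Fintype.card_fin]
    refine le_of_eq ?_
    field_simp
  have hXB : ∀ᵐ ω ∂μ, ∀ i, ‖X i ω‖ ≤ B := by
    refine ae_all_iff.2 fun i => ?_
    have := hQB
    rw [← hlaw i] at this
    exact ae_of_ae_map (hX i).aemeasurable this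
  have hbad := measure_exists_le_average_bernsteinProcess_le hX hlaw hindep hpred (v := v) (c := c)
    hC (fun s i => by
      filter_upwards [hXB] with ω hω
      have hl := hlam i ω
      exact lintegral_bernsteinFactor_le_of_mem_tvBall hPB hQ hε.le hQB (hv s)
        (norm_empMean_le hB.le hω i) hl.1.le (by norm_num at hl; linarith [hl.2]))
    (p := fun _ => (1 / 2) ^ Fintype.card (Fin d)) (fun _ => by positivity)
    (by simp) hα
  set bad := {ω | ∃ n, 1 / α ≤ ∑ s, (1 / 2) ^ Fintype.card (Fin d)
    * bernsteinProcess (v s) c C lam X n ω} with hbaddef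
  have hbadreal : μ.real bad ≤ α := ENNReal.toReal_le_of_le_ofReal hα.le hbad
  have hcover : 1 ≤ μ.real bad + μ.real badᶜ := by
    rw [← probReal_univ (μ := μ), ← Set.union_compl_self bad]
    exact measureReal_union_le _ _
  refine (by linarith : 1 - α ≤ μ.real badᶜ).trans (measureReal_mono ?_)
  intro ω hω t ht
  have hω' : ∑ s, (1 / 2) ^ Fintype.card (Fin d) * bernsteinProcess (v s) c C lam X t ω < 1 / α := by
    by_contra hcon
    exact hω ⟨t, not_lt.1 hcon⟩
  have hdet := norm_sum_smul_sub_le_of_average_bernsteinProcess_lt hB hC hα hω'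
  have hΛ : 0 < ∑ i ∈ Finset.range t, lam i ω :=
    Finset.sum_pos (fun i _ => (hlam i ω).1) (Finset.nonempty_range_iff.2 (by omega))
  rw [Fintype.card_fin] at hdet
  rw [weightedMean_sub_eq hΛ.ne', norm_smul, norm_inv, Real.norm_of_nonneg hΛ.le, ← add_div,
    le_div_iff₀ (by positivity)]
  have hS := norm_nonneg (∑ i ∈ Finset.range t, lam i ω • (X i ω - c))
  have hBd : 0 < B * √(d : ℝ) := by positivity
  -- The slack is spent here: `2 / 3 ≤ 1` on the left, `2B√d ≤ 4B√d` on the right.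
  calc _ = 2 / 3 * ‖∑ i ∈ Finset.range t, lam i ω • (X i ω - c)‖ := by field_simp
    _ ≤ _ := by
      linarith

theorem mainTheorem5 {d : ℕ} {Ω : Type*} [MeasurableSpace Ω] (μ : Measure Ω)
    [IsProbabilityMeasure μ]
    (B : ℝ) (hB : 0 < B)
    (P : Measure (EuclideanSpace ℝ (Fin d))) [IsProbabilityMeasure P]
    (hPB : ∀ᵐ x ∂P, ‖x‖ ≤ B)
    (ε : ℝ) (hε : 0 < ε)
    (Q : Measure (EuclideanSpace ℝ (Fin d))) (hQ : Q ∈ tvBall P ε)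
    (hQB : ∀ᵐ x ∂Q, ‖x‖ ≤ B)
    (X : ℕ → Ω → EuclideanSpace ℝ (Fin d)) (hX : ∀ i, Measurable (X i))
    (hlaw : ∀ i, Measure.map (X i) μ = Q) (hindep : iIndepFun X μ)
    (lam : ℕ → Ω → ℝ) (hlam : ∀ i ω, lam i ω ∈ Set.Ioc (0 : ℝ) 0.8)
    (hpred : PredictableWeights X lam) :
    (∀ α : ℝ, 0 < α → α < 1 →
      1 - α ≤ μ.real {ω | ∀ t : ℕ, 1 ≤ t →
        ‖weightedMean lam X t ω - ∫ x, x ∂P‖ ≤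
          (√(d : ℝ) / (2 * B) * ∑ i ∈ Finset.range t, psiE (lam i ω) * predResidual X i ω ^ 2
              + 4 * B * √(d : ℝ) + 2 * B * √(d : ℝ) * Real.log (1 / α))
            / (2 / 3 * ∑ i ∈ Finset.range t, lam i ω)
          + 2 * B * √(d : ℝ) * (t : ℝ) * Real.log (1 + Real.exp 2 * ε)
            / (2 / 3 * ∑ i ∈ Finset.range t, lam i ω)}) ∧
    (∀ α : ℝ, 0 < α → α ≤ Real.exp (-1) →
      1 - α ≤ μ.real {ω | ∀ t : ℕ, 1 ≤ t →
        ‖weightedMean lam X t ω - ∫ x, x ∂P‖ ≤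
          (√(d : ℝ) / (2 * B) * ∑ i ∈ Finset.range t, psiE (lam i ω) * predResidual X i ω ^ 2
              + 6 * B * √(d : ℝ) * Real.log (1 / α))
            / (2 / 3 * ∑ i ∈ Finset.range t, lam i ω)
          + 2 * B * √(d : ℝ) * (t : ℝ) * Real.log (1 + Real.exp 2 * ε)
            / (2 / 3 * ∑ i ∈ Finset.range t, lam i ω)}) := by
  refine ⟨fun α hα hα1 => measure_norm_weightedMean_sub_le μ hB hPB hε hQ hQB hX hlaw hindep hlam
    hpred hα hα1, fun α hα hα1 => ?_⟩
  refine (measure_norm_weightedMean_sub_le μ hB hPB hε hQ hQB hX hlaw hindep hlam hpred hα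
    (hα1.trans_lt (Real.exp_lt_one_iff.2 (by norm_num)))).trans (measureReal_mono ?_)
  intro ω hω t ht
  refine (hω t ht).trans ?_
  have hΛ : 0 ≤ ∑ i ∈ Finset.range t, lam i ω := Finset.sum_nonneg fun i _ => (hlam i ω).1.le
  -- This absorbs `4B√d` into `4B√d * log (1 / α)`.
  have hlog : 1 ≤ Real.log (1 / α) := by
    rw [one_div, Real.log_inv]
    have := (Real.log_le_iff_le_exp hα).2 hα1
    linarith
  have hBd : 0 ≤ B * √(d : ℝ) := by positivity
  gcongr ?_ / _ + _
  nlinarith
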